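/- Let $n,m\ge 0$ and $d\ge 1$ be integers, let $f\in\mathbb{R}[x]=\mathbb{R}[x_1,\dots,x_n]$ with $\deg f\le 2d$, and let $G$ be a symmetric $m\times m$ matrix of polynomials in $\mathbb{R}[x]$, all of degree at most $2d$. Consider the problem $$(P)\qquad \min\ f(x)\quad\text{s.t.}\quad G(x)\succeq 0,\ x\in\mathbb{R}^n,$$ and let $f_{\min}\in[-\infty,+\infty]$ be its optimal value (infimum; $+\infty$ if infeasible). Definitions. A polynomial $p$ is SOS-convex if its Hessian satisfies $\nabla^2p=P^TP$ for some polynomial matrix $P\in\mathbb{R}[x]^{\ell\times n}$, $\ell\in\mathbb{N}$. The matrix $-G$ is SOS-convex if for every $\xi\in\mathbb{R}^m$ the polynomial $-\xi^TG(x)\xi$ is SOS-convex. Let $\mathrm{QM}[G]_{2d}$ be the set of all polynomials $\sigma+\sum_{t=1}^r v_t^TGv_t$ with $r\in\mathbb{N}$, $\sigma$ a sum of squares of polynomials, $v_t\in\mathbb{R}[x]^m$, $\deg\sigma\le 2d$ and $\deg(v_t^TGv_t)\le 2d$ for all $t$. The SOS bound of order $d$ is $$f_{d,sos}=\sup\{\gamma\in\mathbb{R}: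 f-\gamma\in\mathrm{QM}[G]_{2d}\}\in[-\infty,+\infty].$$ Let $\mathbb{N}^n_{e}=\{\alpha\in\mathbb{N}^n:|\alpha|\le e\}$. For $y\in\mathbb{R}^{\mathbb{N}^n_{2d}}$ let $\mathscr{L}_y(\sum_\alpha p_\alpha x^\alpha)=\sum_\alpha p_\alpha y_\alpha$ for polynomials of degree at most $2d$, and put $\langle f,y\rangle=\mathscr{L}_y(f)$. With $[x]_t$ the vector of monomials of degree at most $t$ and $d_G=\max_{i,j}\lceil\deg(G_{ij})/2\rceil$ (equal to $0$ if $m=0$), let $M_d[y]=\mathscr{L}_y([x]_d[x]_d^T)$ and let $L_G^{(d)}[y]$ be the $m\times m$ block matrix with blocks $\mathscr{L}_y\big(G_{ij}\,[x]_{d-d_G}[x]_{d-d_G}^T\big)$, where $\mathscr{L}_y$ is applied entrywise. The moment relaxation of order $d$ is $$(M)\qquad \min\ \langle f,y\rangle\quad\text{s.t.}\quad L_G^{(d)}[y]\succeq 0,\ M_d[y]\succeq 0,\ y_0=1,\ y\in\mathbb{R}^{\mathbb{N}^n_{2d}},$$ and $f_{d,mom}\in[-\infty,+\infty]$ is its optimal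 value (infimum; $+\infty$ if infeasible). Theorem. Assume that $f$ and $-G$ are SOS-convex. Then: (i) $f_{d,mom}=f_{\min}$. Moreover, if there exists $u\in\mathbb{R}^n$ with $G(u)\succ 0$, then $f_{d,sos}=f_{\min}$. (ii) If $y^*$ is a minimizer of $(M)$, then $u^*=(y^*_{e_1},\dots,y^*_{e_n})$, where $e_i$ is the $i$-th unit vector, is a minimizer of $(P)$. -/

import Mathlib

open MvPolynomial Matrix

namespace PMO

noncomputable section

/-- Evaluation `G(x)` of a polynomial matrix at a point `x ∈ ℝⁿ`. -/
def evalMat {n m : ℕ} (G : Matrix (Fin m) (Fin m) (MvPolynomial (Fin n) ℝ)) (x : Fin n → ℝ) :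
    Matrix (Fin m) (Fin m) ℝ :=
  G.map (eval x)

/-- The feasible set `S(G) = {x ∈ ℝⁿ : G(x) ⪰ 0}`. -/
def feasibleSet {n m : ℕ} (G : Matrix (Fin m) (Fin m) (MvPolynomial (Fin n) ℝ)) :
    Set (Fin n → ℝ) :=
  {x | (evalMat G x).PosSemidef}

/-- The optimal value `f_min` of `min f(x)` subject to `G(x) ⪰ 0`, in the extended reals
(`+∞` when the problem is infeasible, `-∞` when it is unbounded below). -/
def fMin {n m : ℕ} (f : MvPolynomial (Fin n) ℝ)
    (G : Matrix (Fin m) (Fin m) (MvPolynomial (Fin n) ℝ)) : EReal :=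
  ⨅ x ∈ feasibleSet G, ((eval x f : ℝ) : EReal)

/-- `x` is a (global) minimizer of `min f(x)` subject to `G(x) ⪰ 0`. -/
def IsMinimizer {n m : ℕ} (f : MvPolynomial (Fin n) ℝ)
    (G : Matrix (Fin m) (Fin m) (MvPolynomial (Fin n) ℝ)) (x : Fin n → ℝ) : Prop :=
  x ∈ feasibleSet G ∧ ∀ z ∈ feasibleSet G, eval x f ≤ eval z f

/-- The Hessian `∇²f` as a polynomial matrix. -/
def hessian {n : ℕ} (f : MvPolynomial (Fin n) ℝ) :
    Matrix (Fin n) (Fin n) (MvPolynomial (Fin n) ℝ) :=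
  Matrix.of fun i j => pderiv i (pderiv j f)

/-- `f` is SOS-convex: `∇²f = PᵀP` for some polynomial matrix `P ∈ ℝ[x]^{ℓ × n}`. -/
def SOSConvex {n : ℕ} (f : MvPolynomial (Fin n) ℝ) : Prop :=
  ∃ (l : ℕ) (P : Matrix (Fin l) (Fin n) (MvPolynomial (Fin n) ℝ)), hessian f = Pᵀ * P

/-- A polynomial matrix `H` is SOS-convex: `ξᵀHξ` is SOS-convex for every `ξ ∈ ℝᵐ`. -/
def SOSConvexMat {n m : ℕ} (H : Matrix (Fin m) (Fin m) (MvPolynomial (Fin n) ℝ)) : Prop :=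
  ∀ ξ : Fin m → ℝ,
    SOSConvex ((fun i => (C (ξ i) : MvPolynomial (Fin n) ℝ)) ⬝ᵥ (H *ᵥ fun i => C (ξ i)))

/-- The truncation `QM[G]_{2k}` of the quadratic module of `G`. -/
def qmTrunc {n m : ℕ} (G : Matrix (Fin m) (Fin m) (MvPolynomial (Fin n) ℝ)) (k : ℕ) :
    Set (MvPolynomial (Fin n) ℝ) :=
  {p | ∃ (σ : MvPolynomial (Fin n) ℝ) (r : ℕ) (v : Fin r → Fin m → MvPolynomial (Fin n) ℝ),
    IsSumSq σ ∧ σ.totalDegree ≤ 2 * k ∧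
    (∀ t, (v t ⬝ᵥ (G *ᵥ v t)).totalDegree ≤ 2 * k) ∧
    p = σ + ∑ t, v t ⬝ᵥ (G *ᵥ v t)}

/-- The SOS bound `f_{k,sos} = sup {γ : f - γ ∈ QM[G]_{2k}}`, in the extended reals. -/
def sosBound {n m : ℕ} (f : MvPolynomial (Fin n) ℝ)
    (G : Matrix (Fin m) (Fin m) (MvPolynomial (Fin n) ℝ)) (k : ℕ) : EReal :=
  ⨆ γ ∈ {γ : ℝ | f - C γ ∈ qmTrunc G k}, (γ : EReal)

/-- The index set `ℕⁿ_e = {α ∈ ℕⁿ : |α| ≤ e}`. -/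
abbrev MultiIdx (n e : ℕ) : Type := {α : Fin n →₀ ℕ // α.degree ≤ e}

/-- Truncated multi-sequences `y ∈ ℝ^{ℕⁿ_e}`. -/
abbrev TMS (n e : ℕ) : Type := MultiIdx n e → ℝ

/-- The index `0 ∈ ℕⁿ_e`. -/
def zeroIdx (n e : ℕ) : MultiIdx n e := ⟨0, by simp⟩

/-- The index `e_i ∈ ℕⁿ_e`, for `e ≥ 1`. -/
def unitIdx {n e : ℕ} (he : 1 ≤ e) (i : Fin n) : MultiIdx n e :=
  ⟨Finsupp.single i 1, by simpa using he⟩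

/-- The Riesz functional `𝓛_y(∑ p_α x^α) = ∑ p_α y_α` on polynomials of degree at most `e`.
(Monomials of degree larger than `e` never occur where it is used; they are sent to `0`.) -/
def riesz {n e : ℕ} (y : TMS n e) (p : MvPolynomial (Fin n) ℝ) : ℝ :=
  ∑ α ∈ p.support, p.coeff α * (if h : α.degree ≤ e then y ⟨α, h⟩ else 0)

/-- `d_G = max ⌈deg(G_ij) / 2⌉`. -/
def halfDeg {n m : ℕ} (G : Matrix (Fin m) (Fin m) (MvPolynomial (Fin n) ℝ)) : ℕ :=
  Finset.univ.sup fun i => Finset.univ.sup fun j => (G i j).totalDegree ⌈/⌉ 2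

/-- The `k`th order moment matrix `M_k[y] = 𝓛_y([x]_k [x]_kᵀ)`. -/
def momentMatrix {n k : ℕ} (y : TMS n (2 * k)) : Matrix (MultiIdx n k) (MultiIdx n k) ℝ :=
  Matrix.of fun α β => riesz y (monomial α.1 1 * monomial β.1 1)

/-- The `k`th order localizing matrix `L_G^{(k)}[y]`: the `m × m` block matrix with blocks
`𝓛_y(G_ij · [x]_t [x]_tᵀ)`, where `t = k - d_G`. -/
def localizingMatrix {n m k : ℕ} (G : Matrix (Fin m) (Fin m) (MvPolynomial (Fin n) ℝ))
    (y : TMS n (2 * k)) :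
    Matrix (Fin m × MultiIdx n (k - halfDeg G)) (Fin m × MultiIdx n (k - halfDeg G)) ℝ :=
  Matrix.of fun a b => riesz y (G a.1 b.1 * (monomial a.2.1 1 * monomial b.2.1 1))

/-- The feasible set of the `k`th order moment relaxation:
`L_G^{(k)}[y] ⪰ 0`, `M_k[y] ⪰ 0`, `y_0 = 1`. -/
def momFeasible {n m : ℕ} (G : Matrix (Fin m) (Fin m) (MvPolynomial (Fin n) ℝ)) (k : ℕ) :
    Set (TMS n (2 * k)) :=
  {y | (localizingMatrix G y).PosSemidef ∧ (momentMatrix y).PosSemidef ∧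
    y (zeroIdx n (2 * k)) = 1}

/-- The moment bound `f_{k,mom} = inf ⟨f, y⟩` over feasible `y`, in the extended reals. -/
def momBound {n m : ℕ} (f : MvPolynomial (Fin n) ℝ)
    (G : Matrix (Fin m) (Fin m) (MvPolynomial (Fin n) ℝ)) (k : ℕ) : EReal :=
  ⨅ y ∈ momFeasible G k, ((riesz y f : ℝ) : EReal)

/-- `y` is a minimizer of the `k`th order moment relaxation. -/
def IsMomMinimizer {n m : ℕ} (f : MvPolynomial (Fin n) ℝ)
    (G : Matrix (Fin m) (Fin m) (MvPolynomial (Fin n) ℝ)) (k : ℕ) (y : TMS n (2 * k)) : Prop :=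
  y ∈ momFeasible G k ∧ ∀ z ∈ momFeasible G k, riesz y f ≤ riesz z f

end

end PMO

/-!
An SOS-convex polynomial `p` has, at every point `u`, a *tangent decomposition*: `p` is the affine
function `p(u) + a · (x - u)` plus a sum of squares of polynomials vanishing at `u`
(`SOSConvex.exists_decomposition`). After translating `u` to the origin, `xᵀ ∇²p x` multiplies the
coefficient of `x^α` in `p` by `|α|(|α| - 1)` and is a sum of squares of polynomials without
constant term. Undoing this multiplication weights the product of the homogeneous components of
degrees `j` and `l` of such a polynomial by `1 / ((j + l)(j + l - 1)) = ∫₀¹ (1 - s) s^{j+l-2} ds`,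
and these weights form a positive semidefinite matrix, so a sum of squares remains.

*Moment side.* Squares in a sum of squares of degree at most `2d` have roots of degree at most `d`,
so a functional `𝓛_y` with `M_d[y] ⪰ 0` and `y_0 = 1` satisfies Jensen's inequality
`p(u) ≤ 𝓛_y(p)` at its vector `u` of first moments (`SOSConvex.eval_firstMoments_le`). Applied to
`-ξᵀGξ`, this shows that `u` is feasible; applied to `f`, that its objective value does not exceed
`⟨f, y⟩`. Conversely a feasible point gives a feasible `y` by evaluation.

*Sum-of-squares side.* Under Slater's condition separation of convex sets gives a multiplier
`∑ vₜvₜᵀ` such that `L = f - γ - ∑ vₜᵀGvₜ` is nonnegative whenever `γ` is a lower bound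
(`exists_lagrange_multiplier`). The polynomial `L` is again SOS-convex, and a convex polynomial that
is bounded below attains its infimum (`exists_minimizer_of_convexOn`). The linear term of the
tangent decomposition at a minimizer vanishes, so `L` is a sum of squares and `f - γ` lies in the
truncated quadratic module.
-/

namespace PMO

/-! ### The Euler operator -/

/-- The Euler operator `E = ∑ Xᵢ ∂ᵢ`, which multiplies `x^α` by `|α|`. -/
noncomputable def euler {n : ℕ} (p : MvPolynomial (Fin n) ℝ) : MvPolynomial (Fin n) ℝ :=
  ∑ i, X i * pderiv i p

lemma euler_add {n : ℕ} (p q : MvPolynomial (Fin n) ℝ) : euler (p + q) = euler p + euler q := by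
  simp [euler, mul_add, Finset.sum_add_distrib]

lemma coeff_euler {n : ℕ} (p : MvPolynomial (Fin n) ℝ) (α : Fin n →₀ ℕ) :
    coeff α (euler p) = (α.degree : ℝ) * coeff α p := by
  induction p using MvPolynomial.induction_on' with
  | monomial β a =>
    have h : (monomial β a).IsHomogeneous β.degree := isHomogeneous_monomial a rfl
    rw [euler, h.sum_X_mul_pderiv, ← map_nsmul, coeff_monomial, coeff_monomial, nsmul_eq_mul]
    split_ifs with hβ
    · rw [hβ]
    · rw [mul_zero]
  | add p q hp hq => rw [euler_add, coeff_add, hp, hq, coeff_add]; ring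

lemma euler_euler {n : ℕ} (p : MvPolynomial (Fin n) ℝ) :
    euler (euler p) = (fun i => X i) ⬝ᵥ (hessian p *ᵥ fun i => X i) + euler p := by
  have h : ∀ i, pderiv i (euler p) = (∑ j, X j * pderiv i (pderiv j p)) + pderiv i p := by
    intro i
    simp only [euler, map_sum, Derivation.leibniz, smul_eq_mul, Finset.sum_add_distrib]
    congr 1
    rw [Finset.sum_eq_single i]
    · simp
    · intro j _ hj
      simp [pderiv_X_of_ne hj]
    · simp
  conv_lhs => rw [euler]
  simp only [h, mul_add, Finset.sum_add_distrib]
  refine congrArg₂ (· + ·) (Finset.sum_congr rfl fun i _ => congrArg (X i * ·) ?_) rfl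
  exact Finset.sum_congr rfl fun j _ => mul_comm _ _

/-- The operator `p ↦ xᵀ ∇²p x` is diagonal in the monomial basis. -/
lemma coeff_hessian_form {n : ℕ} (p : MvPolynomial (Fin n) ℝ) (α : Fin n →₀ ℕ) :
    coeff α ((fun i => X i) ⬝ᵥ (hessian p *ᵥ fun i => X i)) =
      (α.degree : ℝ) * (α.degree - 1) * coeff α p := by
  have h := congrArg (coeff α) (euler_euler p)
  rw [coeff_add, coeff_euler, coeff_euler] at h
  linarith

lemma eq_affine_of_coeff_eq_zero {n : ℕ} (p : MvPolynomial (Fin n) ℝ)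
    (h : ∀ α : Fin n →₀ ℕ, 2 ≤ α.degree → coeff α p = 0) :
    p = C (coeff 0 p) + ∑ i, C (coeff (Finsupp.single i 1) p) * X i := by
  ext α
  rw [coeff_add, coeff_sum]
  simp only [coeff_C_mul, coeff_X, coeff_C]
  rcases Nat.lt_or_ge α.degree 2 with hα | hα
  · interval_cases hd : α.degree
    · have : α = 0 := (Finsupp.degree_eq_zero_iff α).1 hd
      subst this
      simp
    · obtain ⟨i, rfl⟩ := show α ∈ Set.range fun i => Finsupp.single i 1 by
        rw [Finsupp.range_single_one]; exact hd
      rw [Finset.sum_eq_single i]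
      · simp [eq_comm]
      · intro j _ hj
        simp [Finsupp.single_left_inj, hj]
      · simp
  · have h0 : (0 : Fin n →₀ ℕ) ≠ α := by rintro rfl; simp at hα
    rw [h α hα, if_neg h0, Finset.sum_eq_zero, add_zero]
    intro i _
    rw [if_neg, mul_zero]
    rintro rfl
    simp at hα

/-! ### Weighted sums of squares -/

/-- The matrix `∫₀¹ (1 - s) s^{j+l} ds` is positive semidefinite, as a Gram matrix for the weight
`1 - s` on `[0, 1]`. -/
lemma posSemidef_weightMatrix (N : ℕ) :
    (Matrix.of fun j l : Fin N =>
      (((j : ℕ) + l + 2 : ℝ) * ((j : ℕ) + l + 1))⁻¹).PosSemidef := by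
  have hint : ∀ k : ℕ, ∫ s in (0 : ℝ)..1, (1 - s) * s ^ k = (((k : ℝ) + 2) * (k + 1))⁻¹ := by
    intro k
    have h : ∀ s : ℝ, (1 - s) * s ^ k = s ^ k - s ^ (k + 1) := fun s => by ring
    simp only [h]
    rw [intervalIntegral.integral_sub (by simp) (by simp), integral_pow, integral_pow]
    have h1 : (k : ℝ) + 1 ≠ 0 := by positivity
    have h2 : (k : ℝ) + 2 ≠ 0 := by positivity
    have h3 : (k : ℝ) + 1 + 1 ≠ 0 := by positivity
    push_cast
    simp
    field_simp
    ring
  refine PosSemidef.of_dotProduct_mulVec_nonneg ?_ fun v => ?_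
  · ext i j
    simp [add_comm]
  · have hv : star v ⬝ᵥ ((Matrix.of fun j l : Fin N =>
        (((j : ℕ) + l + 2 : ℝ) * ((j : ℕ) + l + 1))⁻¹) *ᵥ v) =
        ∫ s in (0 : ℝ)..1, (1 - s) * (∑ j, v j * s ^ (j : ℕ)) ^ 2 := by
      have h : ∀ s : ℝ, (1 - s) * (∑ j, v j * s ^ (j : ℕ)) ^ 2 =
          ∑ j, ∑ l, v j * v l * ((1 - s) * s ^ ((j : ℕ) + l)) := by
        intro s
        rw [sq, Finset.sum_mul_sum, Finset.mul_sum]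
        refine Finset.sum_congr rfl fun j _ => ?_
        rw [Finset.mul_sum]
        refine Finset.sum_congr rfl fun l _ => ?_
        ring
      simp only [h]
      rw [intervalIntegral.integral_finsetSum
        fun j _ => Continuous.intervalIntegrable (by fun_prop) _ _]
      simp only [dotProduct, mulVec, star_trivial, Matrix.of_apply, Finset.mul_sum]
      refine Finset.sum_congr rfl fun j _ => ?_
      rw [intervalIntegral.integral_finsetSum
        fun j _ => Continuous.intervalIntegrable (by fun_prop) _ _]
      refine Finset.sum_congr rfl fun l _ => ?_
      rw [intervalIntegral.integral_const_mul, hint]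
      push_cast
      ring
    rw [hv]
    refine intervalIntegral.integral_nonneg zero_le_one fun s hs => ?_
    have := hs.2
    have : 0 ≤ 1 - s := by linarith
    positivity

/-- Dividing the coefficient of `x^α` in a square `g²` with `g(0) = 0` by `|α|(|α| - 1)` gives
a sum of squares again. -/
lemma exists_sumSq_of_sq {n : ℕ} (g : MvPolynomial (Fin n) ℝ) (hg : coeff 0 g = 0) :
    ∃ (N : ℕ) (c : Fin N → MvPolynomial (Fin n) ℝ), (∀ r, coeff 0 (c r) = 0) ∧
      ∀ α : Fin n →₀ ℕ, (α.degree : ℝ) * (α.degree - 1) * coeff α (∑ r, c r * c r) =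
        coeff α (g * g) := by
  obtain ⟨N, v, hv⟩ :=
    Matrix.posSemidef_iff_eq_sum_vecMulVec.1 (posSemidef_weightMatrix g.totalDegree)
  -- As `g` has no constant term, only the components of degrees `1, …, deg g` occur; they are
  -- indexed from `0` to match the weight matrix.
  set h : Fin g.totalDegree → MvPolynomial (Fin n) ℝ :=
    fun j => homogeneousComponent ((j : ℕ) + 1) g with hh
  have hhom : ∀ j, (h j).IsHomogeneous ((j : ℕ) + 1) :=
    fun j => homogeneousComponent_isHomogeneous _ _
  have hgsum : g = ∑ j, h j := by
    conv_lhs => rw [← sum_homogeneousComponent g]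
    rw [Finset.sum_range_succ', homogeneousComponent_zero, hg, C_0, add_zero,
      ← Fin.sum_univ_eq_sum_range (fun j => homogeneousComponent (j + 1) g)]
  refine ⟨N, fun r => ∑ j, C (v r j) * h j, fun r => ?_, fun α => ?_⟩
  · rw [coeff_sum]
    refine Finset.sum_eq_zero fun j _ => ?_
    rw [coeff_C_mul, (hhom j).coeff_eq_zero (by simp), mul_zero]
  · have hK : (∑ r, (∑ j, C (v r j) * h j) * (∑ j, C (v r j) * h j)) =
        ∑ j : Fin g.totalDegree, ∑ l : Fin g.totalDegree,
          C ((((j : ℕ) + l + 2 : ℝ) * ((j : ℕ) + l + 1))⁻¹) * (h j * h l) := by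
      simp only [Finset.sum_mul_sum]
      rw [Finset.sum_comm]
      refine Finset.sum_congr rfl fun j _ => ?_
      rw [Finset.sum_comm]
      refine Finset.sum_congr rfl fun l _ => ?_
      have := congrFun (congrFun hv j) l
      simp only [Matrix.of_apply, Matrix.sum_apply, vecMulVec_apply, star_trivial] at this
      rw [this, map_sum, Finset.sum_mul]
      refine Finset.sum_congr rfl fun r _ => ?_
      rw [C_mul]
      ring
    rw [hK]
    conv_rhs => rw [hgsum, Finset.sum_mul_sum]
    simp only [coeff_sum, Finset.mul_sum, coeff_C_mul]
    refine Finset.sum_congr rfl fun j _ => Finset.sum_congr rfl fun l _ => ?_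
    -- `h j * h l` is homogeneous of degree `j + l + 2`, where the weight cancels the factor.
    by_cases hα : α.degree = ((j : ℕ) + 1) + (l + 1)
    · rw [hα]
      have h1 : ((j : ℕ) + l + 1 : ℝ) ≠ 0 := by positivity
      have h2 : ((j : ℕ) + l + 2 : ℝ) ≠ 0 := by positivity
      push_cast
      field_simp
      ring
    · rw [((hhom j).mul (hhom l)).coeff_eq_zero hα]
      simp

/-! ### Translation and the tangent decomposition -/

/-- The substitution `p(x) ↦ p(x + u)`. -/
noncomputable def translate {n : ℕ} (u : Fin n → ℝ) :
    MvPolynomial (Fin n) ℝ →ₐ[ℝ] MvPolynomial (Fin n) ℝ :=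
  aeval fun i => X i + C (u i)

lemma translate_X {n : ℕ} (u : Fin n → ℝ) (i : Fin n) :
    translate u (X i) = X i + C (u i) := aeval_X _ _

lemma translate_C {n : ℕ} (u : Fin n → ℝ) (a : ℝ) :
    translate u (C a) = C a := algHom_C _ _

lemma translate_neg_translate {n : ℕ} (u : Fin n → ℝ) (p : MvPolynomial (Fin n) ℝ) :
    translate (-u) (translate u p) = p := by
  have h : (translate (-u)).comp (translate u) = AlgHom.id ℝ _ := by
    ext1 i
    simp [translate_X]
  exact DFunLike.congr_fun h p

lemma eval_translate {n : ℕ} (u x : Fin n → ℝ) (p : MvPolynomial (Fin n) ℝ) :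
    eval x (translate u p) = eval (x + u) p := by
  induction p using MvPolynomial.induction_on with
  | C a => rw [translate_C, eval_C, eval_C]
  | add p q hp hq => simp only [map_add, hp, hq]
  | mul_X p i hp => simp only [map_mul, hp, translate_X, map_add, eval_X, eval_C, Pi.add_apply]

lemma pderiv_translate {n : ℕ} (u : Fin n → ℝ) (i : Fin n) (p : MvPolynomial (Fin n) ℝ) :
    pderiv i (translate u p) = translate u (pderiv i p) := by
  induction p using MvPolynomial.induction_on with
  | C a => rw [translate_C, pderiv_C, map_zero]
  | add p q hp hq => simp only [map_add, hp, hq]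
  | mul_X p j hp =>
    by_cases hj : j = i
    · subst hj
      simp [hp, translate_X]
    · simp [hp, translate_X, pderiv_X_of_ne hj]

lemma SOSConvex.translate {n : ℕ} {p : MvPolynomial (Fin n) ℝ} (hp : SOSConvex p)
    (u : Fin n → ℝ) : SOSConvex (translate u p) := by
  obtain ⟨l, P, hP⟩ := hp
  refine ⟨l, P.map (PMO.translate u), ?_⟩
  rw [← Matrix.transpose_map, ← Matrix.map_mul, ← hP]
  ext1 i j
  simp [hessian, pderiv_translate]

lemma SOSConvex.exists_decomposition_zero {n : ℕ} {p : MvPolynomial (Fin n) ℝ}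
    (hp : SOSConvex p) :
    ∃ (a : Fin n → ℝ) (N : ℕ) (c : Fin N → MvPolynomial (Fin n) ℝ),
      (∀ r, coeff 0 (c r) = 0) ∧
      p = C (coeff 0 p) + ∑ i, C (a i) * X i + ∑ r, c r * c r := by
  obtain ⟨l, P, hP⟩ := hp
  have hq0 : ∀ k, coeff 0 ((P *ᵥ fun i => X i) k) = 0 := by
    intro k
    simp only [mulVec, dotProduct, coeff_sum]
    exact Finset.sum_eq_zero fun i _ => by simp [← constantCoeff_eq]
  choose N c hc0 hc using fun k => exists_sumSq_of_sq ((P *ᵥ fun i => X i) k) (hq0 k)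
  have hform : (fun i => X i) ⬝ᵥ (hessian p *ᵥ fun i => X i) =
      ∑ k, (P *ᵥ fun i => X i) k * (P *ᵥ fun i => X i) k := by
    rw [hP, ← mulVec_mulVec, dotProduct_mulVec, vecMul_transpose]
    rfl
  set K := ∑ k, ∑ r, c k r * c k r with hK
  have hKcoeff : ∀ α : Fin n →₀ ℕ, (α.degree : ℝ) * (α.degree - 1) * coeff α K =
      (α.degree : ℝ) * (α.degree - 1) * coeff α p := by
    intro α
    rw [← coeff_hessian_form p, hform, hK, coeff_sum, coeff_sum, Finset.mul_sum]
    exact Finset.sum_congr rfl fun k _ => hc k α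
  have haff := eq_affine_of_coeff_eq_zero (p - K) fun α hα => by
    have h1 : (2 : ℝ) ≤ α.degree := by exact_mod_cast hα
    have h2 : (α.degree : ℝ) * (α.degree - 1) ≠ 0 := by
      apply mul_ne_zero <;> linarith
    rw [coeff_sub, sub_eq_zero]
    exact (mul_left_cancel₀ h2 (hKcoeff α)).symm
  have hK0 : coeff 0 K = 0 := by
    simp only [hK, ← constantCoeff_eq, map_sum, map_mul]
    exact Finset.sum_eq_zero fun k _ => Finset.sum_eq_zero fun r _ => by
      rw [constantCoeff_eq, hc0, mul_zero]
  refine ⟨fun i => coeff (Finsupp.single i 1) (p - K), ∑ k, N k,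
    fun r => c (finSigmaFinEquiv.symm r).1 (finSigmaFinEquiv.symm r).2,
    fun r => hc0 _ _, ?_⟩
  rw [Equiv.sum_comp finSigmaFinEquiv.symm fun r => c r.1 r.2 * c r.1 r.2, Fintype.sum_sigma,
    ← hK]
  have h0 : coeff 0 (p - K) = coeff 0 p := by rw [coeff_sub, hK0, sub_zero]
  rw [h0] at haff
  exact sub_eq_iff_eq_add.1 haff

/-- The remainder of the first-order Taylor expansion of an SOS-convex polynomial at `u` is a sum
of squares of polynomials vanishing at `u`. -/
lemma SOSConvex.exists_decomposition {n : ℕ} {p : MvPolynomial (Fin n) ℝ}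
    (hp : SOSConvex p) (u : Fin n → ℝ) :
    ∃ (a : Fin n → ℝ) (N : ℕ) (c : Fin N → MvPolynomial (Fin n) ℝ),
      (∀ r, eval u (c r) = 0) ∧
      p = C (eval u p) + ∑ i, C (a i) * (X i - C (u i)) + ∑ r, c r * c r := by
  obtain ⟨a, N, c, hc, h⟩ := (hp.translate u).exists_decomposition_zero
  have h0 : ∀ q : MvPolynomial (Fin n) ℝ, coeff 0 q = eval 0 q := fun q => by
    rw [← constantCoeff_eq, ← eval_zero]
  refine ⟨a, N, fun r => PMO.translate (-u) (c r), fun r => ?_, ?_⟩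
  · rw [eval_translate, add_neg_cancel, ← h0, hc]
  · have h' := congrArg (PMO.translate (-u)) h
    rw [translate_neg_translate, h0, eval_translate, zero_add] at h'
    conv_lhs => rw [h']
    simp [translate_X, sub_eq_add_neg]

/-! ### Degrees of sums of squares -/

/-- Leading terms of squares of real polynomials do not cancel. -/
lemma totalDegree_le_of_sumSq {n N d : ℕ} (c : Fin N → MvPolynomial (Fin n) ℝ)
    (h : (∑ r, c r * c r).totalDegree ≤ 2 * d) (r : Fin N) : (c r).totalDegree ≤ d := by
  let mo : MonomialOrder (Fin n) := MonomialOrder.degLex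
  have : Nonempty (Fin N) := ⟨r⟩
  obtain ⟨s, hs⟩ := Finite.exists_max fun t => mo.toSyn (mo.degree (c t))
  have hle : (c r).totalDegree ≤ (c s).totalDegree := degLex_totalDegree_monotone (hs r)
  refine hle.trans ?_
  by_cases h0 : c s = 0
  · simp [h0]
  -- At twice the largest leading exponent, the coefficient is a sum of squares of reals.
  set β := mo.degree (c s) with hβ
  have hcoeff : coeff (β + β) (∑ t, c t * c t) = ∑ t, coeff β (c t) * coeff β (c t) := by
    rw [coeff_sum]
    exact Finset.sum_congr rfl fun t _ => mo.coeff_mul_of_add_of_degree_le (hs t) (hs t)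
  have hpos : 0 < coeff (β + β) (∑ t, c t * c t) := by
    rw [hcoeff]
    refine Finset.sum_pos' (fun t _ => mul_self_nonneg _) ⟨s, Finset.mem_univ _, ?_⟩
    exact mul_self_pos.2 (mo.leadingCoeff_ne_zero_iff.2 h0)
  have hdeg := le_totalDegree (mem_support_iff.2 hpos.ne')
  have hβd : β.degree = (c s).totalDegree := degree_degLexDegree
  have : (β + β).degree ≤ 2 * d := hdeg.trans h
  rw [map_add] at this
  omega

/-! ### The Riesz functional -/

/-- The Riesz functional as a linear map on all polynomials; monomials of degree larger than `e`
are sent to `0`. -/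
noncomputable def rieszLin {n e : ℕ} (y : TMS n e) : MvPolynomial (Fin n) ℝ →ₗ[ℝ] ℝ :=
  (basisMonomials (Fin n) ℝ).constr ℝ fun α => if h : α.degree ≤ e then y ⟨α, h⟩ else 0

lemma rieszLin_monomial {n e : ℕ} (y : TMS n e) (α : Fin n →₀ ℕ) (a : ℝ) :
    rieszLin y (monomial α a) = a * (if h : α.degree ≤ e then y ⟨α, h⟩ else 0) := by
  have h : monomial α a = a • (basisMonomials (Fin n) ℝ) α := by
    simp [smul_monomial]
  rw [h, map_smul, rieszLin, Module.Basis.constr_basis, smul_eq_mul]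

lemma riesz_eq_rieszLin {n e : ℕ} (y : TMS n e) (p : MvPolynomial (Fin n) ℝ) :
    riesz y p = rieszLin y p := by
  conv_rhs => rw [p.as_sum, map_sum]
  simp only [rieszLin_monomial, riesz]

lemma rieszLin_C {n e : ℕ} (y : TMS n e) (a : ℝ) :
    rieszLin y (C a) = a * y (zeroIdx n e) := by
  rw [C_apply, rieszLin_monomial, dif_pos (by simp)]
  rfl

lemma rieszLin_X {n e : ℕ} (he : 1 ≤ e) (y : TMS n e) (i : Fin n) :
    rieszLin y (X i) = y (unitIdx he i) := by
  rw [X, rieszLin_monomial, dif_pos (by simpa using he), one_mul]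
  rfl

lemma rieszLin_C_mul {n e : ℕ} (y : TMS n e) (a : ℝ) (p : MvPolynomial (Fin n) ℝ) :
    rieszLin y (C a * p) = a * rieszLin y p := by
  rw [← smul_eq_C_mul, map_smul, smul_eq_mul]

/-- The truncated multi-sequence of the point evaluation at `x`. -/
noncomputable def evalTMS {n : ℕ} (e : ℕ) (x : Fin n → ℝ) : TMS n e :=
  fun α => eval x (monomial α.1 1)

lemma riesz_evalTMS {n e : ℕ} (x : Fin n → ℝ) {p : MvPolynomial (Fin n) ℝ}
    (hp : p.totalDegree ≤ e) : riesz (evalTMS e x) p = eval x p := by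
  conv_rhs => rw [p.as_sum, map_sum]
  refine Finset.sum_congr rfl fun α hα => ?_
  have h : α.degree ≤ e := (le_totalDegree hα).trans hp
  rw [dif_pos h, evalTMS, eval_monomial, eval_monomial, one_mul]

noncomputable instance instFintypeMultiIdx (n e : ℕ) : Fintype (MultiIdx n e) :=
  (Finsupp.finite_of_degree_le (σ := Fin n) e).fintype

lemma sum_multiIdx_eq {n k : ℕ} {g : MvPolynomial (Fin n) ℝ} (hg : g.totalDegree ≤ k) :
    ∑ α : MultiIdx n k, C (coeff α.1 g) * monomial α.1 1 = g := by
  ext β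
  simp only [coeff_sum, coeff_C_mul, coeff_monomial, mul_ite, mul_one, mul_zero]
  by_cases hβ : β.degree ≤ k
  · rw [Finset.sum_eq_single ⟨β, hβ⟩ (fun α _ hα => if_neg fun h => hα (Subtype.ext h))
      (fun h => absurd (Finset.mem_univ _) h), if_pos rfl]
  · rw [coeff_eq_zero_of_totalDegree_lt (hg.trans_lt (not_le.1 hβ))]
    exact Finset.sum_eq_zero fun α _ => if_neg fun h => hβ (by rw [← h]; exact α.2)

lemma rieszLin_sq_nonneg {n k : ℕ} {y : TMS n (2 * k)} (hy : (momentMatrix y).PosSemidef)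
    {g : MvPolynomial (Fin n) ℝ} (hg : g.totalDegree ≤ k) : 0 ≤ rieszLin y (g * g) := by
  have h := hy.dotProduct_mulVec_nonneg fun α => coeff α.1 g
  refine h.trans_eq ?_
  conv_rhs => rw [← sum_multiIdx_eq hg, Finset.sum_mul_sum, map_sum]
  simp only [dotProduct, mulVec, momentMatrix, Matrix.of_apply, star_trivial, Finset.mul_sum,
    map_sum, Pi.star_apply]
  refine Finset.sum_congr rfl fun α _ => Finset.sum_congr rfl fun β _ => ?_
  rw [mul_mul_mul_comm, ← C_mul, rieszLin_C_mul, riesz_eq_rieszLin]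
  ring

/-! ### Jensen's inequality for the Riesz functional -/

/-- The point `(y_{e_1}, …, y_{e_n})` of first-order moments. -/
noncomputable def firstMoments {n e : ℕ} (he : 1 ≤ e) (y : TMS n e) : Fin n → ℝ :=
  fun i => y (unitIdx he i)

lemma totalDegree_affine_le {n : ℕ} (b : ℝ) (a u : Fin n → ℝ) :
    (C b + ∑ i, C (a i) * (X i - C (u i)) : MvPolynomial (Fin n) ℝ).totalDegree ≤ 1 := by
  refine (totalDegree_add _ _).trans (max_le (by simp) ?_)
  refine (totalDegree_finsetSum_le fun i _ => ?_)
  refine (totalDegree_mul _ _).trans ?_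
  rw [totalDegree_C, zero_add]
  exact (totalDegree_sub_C_le _ _).trans (by simp)

/-- Jensen's inequality: apply the functional to the tangent decomposition at the first moments. -/
lemma SOSConvex.eval_firstMoments_le {n d : ℕ} (hd : 1 ≤ 2 * d) {p : MvPolynomial (Fin n) ℝ}
    (hp : SOSConvex p) (hdeg : p.totalDegree ≤ 2 * d) {y : TMS n (2 * d)}
    (hy : (momentMatrix y).PosSemidef) (hy0 : y (zeroIdx n (2 * d)) = 1) :
    eval (firstMoments hd y) p ≤ riesz y p := by
  set u := firstMoments hd y with hu
  obtain ⟨a, N, c, -, h⟩ := hp.exists_decomposition u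
  have hcdeg : ∀ r, (c r).totalDegree ≤ d := by
    refine totalDegree_le_of_sumSq c ?_
    rw [eq_sub_of_add_eq' h.symm]
    refine (totalDegree_sub _ _).trans (max_le hdeg ?_)
    exact (totalDegree_affine_le _ _ _).trans hd
  rw [riesz_eq_rieszLin]
  conv_rhs => rw [h]
  simp only [map_add, map_sum, rieszLin_C_mul, map_sub, rieszLin_C, rieszLin_X hd, hy0, mul_one]
  have h1 : ∑ i, a i * (y (unitIdx hd i) - u i) = 0 :=
    Finset.sum_eq_zero fun i _ => by simp [hu, firstMoments]
  rw [h1, add_zero]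
  exact le_add_of_nonneg_right (Finset.sum_nonneg fun r _ => rieszLin_sq_nonneg hy (hcdeg r))

/-! ### The moment relaxation is exact -/

lemma totalDegree_quadForm_le {n m e : ℕ} {G : Matrix (Fin m) (Fin m) (MvPolynomial (Fin n) ℝ)}
    (hG : ∀ i j, (G i j).totalDegree ≤ e) (ξ : Fin m → ℝ) :
    ((fun i => C (ξ i)) ⬝ᵥ (G *ᵥ fun i => C (ξ i))).totalDegree ≤ e := by
  refine totalDegree_finsetSum_le fun i _ => (totalDegree_mul _ _).trans ?_
  rw [totalDegree_C, zero_add]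
  refine totalDegree_finsetSum_le fun j _ => (totalDegree_mul _ _).trans ?_
  rw [totalDegree_C, add_zero]
  exact hG i j

lemma eval_quadForm {n m : ℕ} (G : Matrix (Fin m) (Fin m) (MvPolynomial (Fin n) ℝ))
    (ξ : Fin m → ℝ) (x : Fin n → ℝ) :
    eval x ((fun i => C (ξ i)) ⬝ᵥ (G *ᵥ fun i => C (ξ i))) = ξ ⬝ᵥ (evalMat G x *ᵥ ξ) := by
  simp [dotProduct, mulVec, evalMat]

lemma isHermitian_evalMat {n m : ℕ} {G : Matrix (Fin m) (Fin m) (MvPolynomial (Fin n) ℝ)}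
    (hG : G.IsSymm) (x : Fin n → ℝ) : (evalMat G x).IsHermitian := by
  ext i j
  simp [evalMat, hG.apply i j]

/-- The first moments of a feasible point of the relaxation are feasible: Jensen's inequality for
`-ξᵀGξ` gives `ξᵀG(u)ξ ≥ ξᵀ𝓛_y(G)ξ ≥ 0`. -/
lemma firstMoments_mem_feasibleSet {n m d : ℕ} (hd : 1 ≤ 2 * d)
    {G : Matrix (Fin m) (Fin m) (MvPolynomial (Fin n) ℝ)}
    (hG : G.IsSymm) (hGdeg : ∀ i j, (G i j).totalDegree ≤ 2 * d) (hGconv : SOSConvexMat (-G))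
    {y : TMS n (2 * d)} (hy : y ∈ momFeasible G d) :
    firstMoments hd y ∈ feasibleSet G := by
  obtain ⟨hL, hM, hy0⟩ := hy
  refine PosSemidef.of_dotProduct_mulVec_nonneg (isHermitian_evalMat hG _) fun ξ => ?_
  rw [star_trivial]
  have h1 := (hGconv ξ).eval_firstMoments_le hd
    (totalDegree_quadForm_le (fun i j => by simpa using hGdeg i j) ξ) hM hy0
  -- The block of the localizing matrix at the constant monomial is `𝓛_y(G)`.
  have h2 := (hL.submatrix fun i : Fin m =>
    (i, zeroIdx n (d - halfDeg G))).dotProduct_mulVec_nonneg ξ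
  have h3 : star ξ ⬝ᵥ (((localizingMatrix G y).submatrix
      (fun i : Fin m => (i, zeroIdx n (d - halfDeg G)))
      (fun i : Fin m => (i, zeroIdx n (d - halfDeg G)))) *ᵥ ξ) =
      rieszLin y ((fun i => C (ξ i)) ⬝ᵥ (G *ᵥ fun i => C (ξ i))) := by
    simp only [dotProduct, mulVec, star_trivial, map_sum, rieszLin_C_mul]
    refine Finset.sum_congr rfl fun i _ => congrArg (ξ i * ·) (Finset.sum_congr rfl fun j _ => ?_)
    rw [mul_comm (G i j), rieszLin_C_mul, mul_comm]
    simp [localizingMatrix, zeroIdx, riesz_eq_rieszLin]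
  rw [h3] at h2
  rw [riesz_eq_rieszLin, neg_mulVec, dotProduct_neg, map_neg, map_neg, eval_quadForm] at h1
  linarith

lemma halfDeg_le {n m d : ℕ} {G : Matrix (Fin m) (Fin m) (MvPolynomial (Fin n) ℝ)}
    (hGdeg : ∀ i j, (G i j).totalDegree ≤ 2 * d) : halfDeg G ≤ d := by
  refine Finset.sup_le fun i _ => Finset.sup_le fun j _ => ?_
  have := hGdeg i j
  rw [Nat.ceilDiv_eq_add_pred_div]
  omega

lemma totalDegree_le_two_mul_halfDeg {n m : ℕ}
    (G : Matrix (Fin m) (Fin m) (MvPolynomial (Fin n) ℝ)) (i j : Fin m) :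
    (G i j).totalDegree ≤ 2 * halfDeg G := by
  have h : (G i j).totalDegree ⌈/⌉ 2 ≤ halfDeg G :=
    (Finset.le_sup (f := fun j => (G i j).totalDegree ⌈/⌉ 2) (Finset.mem_univ j)).trans
      (Finset.le_sup (f := fun i => Finset.univ.sup fun j => (G i j).totalDegree ⌈/⌉ 2)
        (Finset.mem_univ i))
  rw [Nat.ceilDiv_eq_add_pred_div] at h
  omega

/-- Evaluation at a feasible point is feasible for the relaxation: its localizing matrix is
`Wᵀ G(x) W` with `W = I ⊗ [x]ᵀ`, and its moment matrix is `[x] [x]ᵀ`. -/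
lemma evalTMS_mem_momFeasible {n m d : ℕ} {G : Matrix (Fin m) (Fin m) (MvPolynomial (Fin n) ℝ)}
    (hGdeg : ∀ i j, (G i j).totalDegree ≤ 2 * d) {x : Fin n → ℝ} (hx : x ∈ feasibleSet G) :
    evalTMS (2 * d) x ∈ momFeasible G d := by
  have hhalf := halfDeg_le hGdeg
  refine ⟨?_, ?_, by simp [evalTMS, zeroIdx]⟩
  · have h : localizingMatrix G (evalTMS (2 * d) x) =
        (Matrix.of fun i b => if i = b.1 then eval x (monomial b.2.1 1) else 0 :
          Matrix (Fin m) (Fin m × MultiIdx n (d - halfDeg G)) ℝ)ᴴ * evalMat G x *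
        (Matrix.of fun i b => if i = b.1 then eval x (monomial b.2.1 1) else 0 :
          Matrix (Fin m) (Fin m × MultiIdx n (d - halfDeg G)) ℝ) := by
      ext a b
      have hdeg : (G a.1 b.1 * (monomial a.2.1 1 * monomial b.2.1 1)).totalDegree ≤ 2 * d := by
        have h1 := totalDegree_le_two_mul_halfDeg G a.1 b.1
        have h2 := a.2.2
        have h3 := b.2.2
        refine (totalDegree_mul _ _).trans ?_
        rw [monomial_mul]
        have h4 := totalDegree_monomial_le (a.2.1 + b.2.1) (1 * 1 : ℝ)
        rw [show ((a.2.1 + b.2.1).sum fun _ => id) = (a.2.1 + b.2.1).degree from rfl,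
          map_add] at h4
        omega
      rw [localizingMatrix, Matrix.of_apply, riesz_evalTMS x hdeg]
      simp only [Matrix.mul_apply, conjTranspose_apply, Matrix.of_apply, star_trivial, ite_mul,
        zero_mul, mul_ite, mul_zero, Finset.sum_ite_eq', Finset.mem_univ, if_true, map_mul,
        evalMat, Matrix.map_apply]
      ring
    rw [h]
    exact PosSemidef.conjTranspose_mul_mul_same hx _
  · have h : momentMatrix (evalTMS (2 * d) x) =
        vecMulVec (fun α : MultiIdx n d => eval x (monomial α.1 1))
          (star fun α : MultiIdx n d => eval x (monomial α.1 1)) := by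
      ext a b
      have hdeg : (monomial a.1 1 * monomial b.1 1 : MvPolynomial (Fin n) ℝ).totalDegree
          ≤ 2 * d := by
        have h2 := a.2
        have h3 := b.2
        rw [monomial_mul]
        have h4 := totalDegree_monomial_le (a.1 + b.1) (1 * 1 : ℝ)
        rw [show ((a.1 + b.1).sum fun _ => id) = (a.1 + b.1).degree from rfl,
          map_add] at h4
        omega
      rw [momentMatrix, Matrix.of_apply, riesz_evalTMS x hdeg, map_mul, vecMulVec_apply]
      simp
    rw [h]
    exact posSemidef_vecMulVec_self_star _

theorem momBound_eq_fMin {n m d : ℕ} (hd : 1 ≤ 2 * d) {f : MvPolynomial (Fin n) ℝ}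
    {G : Matrix (Fin m) (Fin m) (MvPolynomial (Fin n) ℝ)} (hG : G.IsSymm)
    (hfdeg : f.totalDegree ≤ 2 * d) (hGdeg : ∀ i j, (G i j).totalDegree ≤ 2 * d)
    (hf : SOSConvex f) (hGconv : SOSConvexMat (-G)) : momBound f G d = fMin f G := by
  refine le_antisymm (le_iInf₂ fun x hx => ?_) (le_iInf₂ fun y hy => ?_)
  · exact (iInf₂_le _ (evalTMS_mem_momFeasible hGdeg hx)).trans_eq
      (by rw [riesz_evalTMS x hfdeg])
  · exact (iInf₂_le _ (firstMoments_mem_feasibleSet hd hG hGdeg hGconv hy)).trans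
      (EReal.coe_le_coe_iff.2 (hf.eval_firstMoments_le hd hfdeg hy.2.1 hy.2.2))

theorem IsMomMinimizer.isMinimizer_firstMoments {n m d : ℕ} (hd : 1 ≤ 2 * d)
    {f : MvPolynomial (Fin n) ℝ}
    {G : Matrix (Fin m) (Fin m) (MvPolynomial (Fin n) ℝ)} (hG : G.IsSymm)
    (hfdeg : f.totalDegree ≤ 2 * d) (hGdeg : ∀ i j, (G i j).totalDegree ≤ 2 * d)
    (hf : SOSConvex f) (hGconv : SOSConvexMat (-G)) {y : TMS n (2 * d)}
    (hy : IsMomMinimizer f G d y) : IsMinimizer f G (firstMoments hd y) := by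
  refine ⟨firstMoments_mem_feasibleSet hd hG hGdeg hGconv hy.1, fun z hz => ?_⟩
  calc eval (firstMoments hd y) f ≤ riesz y f :=
        hf.eval_firstMoments_le hd hfdeg hy.1.2.1 hy.1.2.2
    _ ≤ riesz (evalTMS (2 * d) z) f := hy.2 _ (evalTMS_mem_momFeasible hGdeg hz)
    _ = eval z f := riesz_evalTMS z hfdeg

/-! ### Convexity and attainment of the infimum -/

lemma SOSConvex.convexOn {n : ℕ} {p : MvPolynomial (Fin n) ℝ} (hp : SOSConvex p) :
    ConvexOn ℝ Set.univ fun x => eval x p := by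
  refine ⟨convex_univ, fun x _ y _ α β hα hβ hαβ => ?_⟩
  obtain ⟨a, N, c, -, h⟩ := hp.exists_decomposition (α • x + β • y)
  have hz : ∀ z, eval z p = eval (α • x + β • y) p +
      a ⬝ᵥ (z - (α • x + β • y)) + ∑ r, eval z (c r) * eval z (c r) := by
    intro z
    conv_lhs => rw [h]
    simp [dotProduct]
  have hx := hz x
  have hy := hz y
  have hxs : 0 ≤ ∑ r, eval x (c r) * eval x (c r) :=
    Finset.sum_nonneg fun r _ => mul_self_nonneg _
  have hys : 0 ≤ ∑ r, eval y (c r) * eval y (c r) :=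
    Finset.sum_nonneg fun r _ => mul_self_nonneg _
  have hlin : α * (a ⬝ᵥ (x - (α • x + β • y))) + β * (a ⬝ᵥ (y - (α • x + β • y))) = 0 := by
    simp only [dotProduct_sub, dotProduct_add, dotProduct_smul, smul_eq_mul]
    linear_combination (-(α * (a ⬝ᵥ x) + β * (a ⬝ᵥ y))) * hαβ
  simp only [smul_eq_mul]
  have h1 : α * (eval (α • x + β • y) p + a ⬝ᵥ (x - (α • x + β • y))) ≤ α * eval x p :=
    mul_le_mul_of_nonneg_left (by linarith) hα
  have h2 : β * (eval (α • x + β • y) p + a ⬝ᵥ (y - (α • x + β • y))) ≤ β * eval y p :=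
    mul_le_mul_of_nonneg_left (by linarith) hβ
  have h3 : α * eval (α • x + β • y) p + β * eval (α • x + β • y) p =
      eval (α • x + β • y) p := by rw [← add_mul, hαβ, one_mul]
  linarith

/-- The univariate polynomial `t ↦ p(x + t v)`. -/
noncomputable def alongLine {n : ℕ} (x v : Fin n → ℝ) (p : MvPolynomial (Fin n) ℝ) :
    Polynomial ℝ :=
  aeval (fun i => Polynomial.C (x i) + Polynomial.C (v i) * Polynomial.X) p

lemma eval_alongLine {n : ℕ} (x v : Fin n → ℝ) (p : MvPolynomial (Fin n) ℝ) (t : ℝ) :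
    (alongLine x v p).eval t = eval (x + t • v) p := by
  induction p using MvPolynomial.induction_on with
  | C a => simp [alongLine]
  | add p q hp hq => simp only [alongLine, map_add, Polynomial.eval_add] at hp hq ⊢; rw [hp, hq]
  | mul_X p i hp =>
    simp only [alongLine, map_mul, Polynomial.eval_mul] at hp ⊢
    rw [hp]
    simp only [aeval_X, Polynomial.eval_add, Polynomial.eval_mul, Polynomial.eval_C,
      Polynomial.eval_X, eval_X, Pi.add_apply, Pi.smul_apply, smul_eq_mul, mul_comm (v i)]

/-- A polynomial bounded along a ray is constant along the whole line. -/
lemma eval_add_smul_eq_of_bounded {n : ℕ} {p : MvPolynomial (Fin n) ℝ} {x v : Fin n → ℝ}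
    {a b : ℝ} (ha : ∀ t : ℝ, 0 ≤ t → a ≤ eval (x + t • v) p)
    (hb : ∀ t : ℝ, 0 ≤ t → eval (x + t • v) p ≤ b) (t : ℝ) :
    eval (x + t • v) p = eval x p := by
  have hdeg : (alongLine x v p).degree ≤ 0 := by
    rw [← Polynomial.isBoundedUnder_abs_atTop_iff]
    refine Filter.isBoundedUnder_of_eventually_le (a := max |a| |b|) ?_
    filter_upwards [Filter.eventually_ge_atTop 0] with t ht
    rw [eval_alongLine]
    exact abs_le_max_abs_abs (ha t ht) (hb t ht)
  have h0 := eval_alongLine x v p 0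
  rw [zero_smul, add_zero] at h0
  rw [← eval_alongLine, ← h0, Polynomial.eq_C_of_degree_le_zero hdeg, Polynomial.eval_C,
    Polynomial.eval_C]

open Filter Topology in
/-- A convex polynomial that is bounded below attains its infimum. If the points of least norm in
the sublevel sets were unbounded, a limit `v` of their directions would be a direction along which
the polynomial is constant, and moving them along `-v` would decrease their norm. -/
lemma exists_minimizer_of_convexOn {n : ℕ} {p : MvPolynomial (Fin n) ℝ}
    (hconv : ConvexOn ℝ Set.univ fun x => eval x p) {b : ℝ} (hb : ∀ x, b ≤ eval x p) :
    ∃ u, ∀ x, eval u p ≤ eval x p := by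
  have hcont : Continuous fun x : Fin n → ℝ => eval x p := MvPolynomial.continuous_eval p
  set μ : ℝ := ⨅ x, eval x p with hμ
  have hbdd : BddBelow (Set.range fun x => eval x p) := ⟨b, by rintro _ ⟨x, rfl⟩; exact hb x⟩
  have hμle : ∀ x, μ ≤ eval x p := fun x => ciInf_le hbdd x
  have hε : ∀ k : ℕ, (0 : ℝ) < 1 / ((k : ℝ) + 1) := fun k => by positivity
  have hex : ∀ k : ℕ, ∃ x : Fin n → ℝ, eval x p ≤ μ + 1 / ((k : ℝ) + 1) ∧
      ∀ z : Fin n → ℝ, eval z p ≤ μ + 1 / ((k : ℝ) + 1) → ‖x‖ ≤ ‖z‖ := by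
    intro k
    have hne : {x : Fin n → ℝ | eval x p ≤ μ + 1 / ((k : ℝ) + 1)}.Nonempty := by
      obtain ⟨x, hx⟩ := exists_lt_of_ciInf_lt (lt_add_of_pos_right μ (hε k))
      exact ⟨x, hx.le⟩
    have hcl : IsClosed {x : Fin n → ℝ | eval x p ≤ μ + 1 / ((k : ℝ) + 1)} :=
      isClosed_le hcont continuous_const
    obtain ⟨x, hx, hxd⟩ := hcl.exists_infDist_eq_dist hne 0
    refine ⟨x, hx, fun z hz => ?_⟩
    have := Metric.infDist_le_dist_of_mem (x := 0)
      (show z ∈ {x : Fin n → ℝ | eval x p ≤ μ + 1 / ((k : ℝ) + 1)} from hz)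
    rwa [hxd, dist_zero_left, dist_zero_left] at this
  choose x hx hmin using hex
  have hmono : Monotone fun k => ‖x k‖ := fun k l hkl => hmin k (x l)
    ((hx l).trans (add_le_add_right (Nat.one_div_le_one_div hkl) μ))
  have hlim : Tendsto (fun k => eval (x k) p) atTop (𝓝 μ) := by
    refine tendsto_of_tendsto_of_tendsto_of_le_of_le tendsto_const_nhds ?_
      (fun k => hμle (x k)) hx
    simpa using tendsto_const_nhds.add (tendsto_one_div_add_atTop_nhds_zero_nat (𝕜 := ℝ))
  rcases tendsto_atTop_of_monotone hmono with htop | ⟨R, hR⟩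
  -- The points escape to infinity: `v` is a limit of their directions.
  · exfalso
    have hball : ∀ k, ‖x k‖⁻¹ • x k ∈ Metric.closedBall (0 : Fin n → ℝ) 1 := by
      intro k
      rw [mem_closedBall_zero_iff, norm_smul, norm_inv, norm_norm]
      exact inv_mul_le_one
    obtain ⟨v, -, φ, hφ, hv⟩ := (isCompact_closedBall (0 : Fin n → ℝ) 1).tendsto_subseq hball
    have htop' := htop.comp hφ.tendsto_atTop
    -- `z + t v` is a limit of points on the segments from `z` to `x (φ k)`.
    have hrec : ∀ (z : Fin n → ℝ) (t : ℝ), 0 ≤ t → eval (z + t • v) p ≤ eval z p := by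
      intro z t ht
      have hs : Tendsto (fun k => t * ‖x (φ k)‖⁻¹) atTop (𝓝 0) := by
        simpa using (tendsto_inv_atTop_zero.comp htop').const_mul t
      have hpt : Tendsto (fun k => (1 - t * ‖x (φ k)‖⁻¹) • z + (t * ‖x (φ k)‖⁻¹) • x (φ k))
          atTop (𝓝 (z + t • v)) := by
        have h1 := ((tendsto_const_nhds (x := (1 : ℝ))).sub hs).smul_const z
        rw [sub_zero, one_smul] at h1
        refine h1.add ?_
        simp only [mul_smul]
        exact hv.const_smul t
      have hup : Tendsto (fun k => (1 - t * ‖x (φ k)‖⁻¹) * eval z p +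
          (t * ‖x (φ k)‖⁻¹) * (μ + 1)) atTop (𝓝 (eval z p)) := by
        have h1 := (((tendsto_const_nhds (x := (1 : ℝ))).sub hs).mul_const (eval z p)).add
          (hs.mul_const (μ + 1))
        simpa using h1
      refine le_of_tendsto_of_tendsto ((hcont.tendsto _).comp hpt) hup ?_
      filter_upwards [hs.eventually_le_const one_pos] with k hk
      have hk0 : 0 ≤ t * ‖x (φ k)‖⁻¹ := by positivity
      have h1 := hconv.2 (Set.mem_univ z) (Set.mem_univ (x (φ k))) (sub_nonneg.2 hk) hk0 (by ring)
      have h2 : eval (x (φ k)) p ≤ μ + 1 := by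
        refine (hx (φ k)).trans (add_le_add_right ?_ μ)
        rw [div_le_one (by positivity)]
        linarith [(φ k).cast_nonneg (α := ℝ)]
      simp only [smul_eq_mul] at h1
      exact h1.trans (by gcongr)
    have hconst : ∀ (z : Fin n → ℝ) (t : ℝ), eval (z + t • v) p = eval z p := fun z =>
      eval_add_smul_eq_of_bounded (fun t _ => hb _) (hrec z)
    have hnear : ∀ᶠ k in atTop, dist (‖x (φ k)‖⁻¹ • x (φ k)) v < 1 :=
      (Metric.tendsto_nhds.1 hv) 1 one_pos
    obtain ⟨k, hk, hkpos⟩ := (hnear.and (htop'.eventually_gt_atTop 0)).exists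
    simp only [Function.comp_apply] at hkpos
    -- Moving `x (φ k)` by `-‖x (φ k)‖ v` stays in the sublevel set and decreases the norm.
    have h1 := hmin (φ k) (x (φ k) + (-‖x (φ k)‖) • v) (by rw [hconst]; exact hx (φ k))
    have h2 : x (φ k) + (-‖x (φ k)‖) • v = ‖x (φ k)‖ • (‖x (φ k)‖⁻¹ • x (φ k) - v) := by
      rw [smul_sub, smul_smul, mul_inv_cancel₀ hkpos.ne', one_smul, neg_smul, sub_eq_add_neg]
    rw [h2, norm_smul, norm_norm, ← dist_eq_norm] at h1
    nlinarith
  · have hball : ∀ k, x k ∈ Metric.closedBall (0 : Fin n → ℝ) R := fun k =>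
      mem_closedBall_zero_iff.2 (hmono.ge_of_tendsto hR k)
    obtain ⟨u, -, φ, hφ, hu⟩ := (isCompact_closedBall (0 : Fin n → ℝ) R).tendsto_subseq hball
    have h1 := (hcont.tendsto u).comp hu
    have h2 := hlim.comp hφ.tendsto_atTop
    exact ⟨u, fun z => (tendsto_nhds_unique h1 h2).trans_le (hμle z)⟩

/-- An SOS-convex polynomial that is bounded below is a sum of squares up to its minimum, since
the linear term of the tangent decomposition vanishes at a minimizer. -/
lemma SOSConvex.exists_eq_min_add_sumSq {n : ℕ} {p : MvPolynomial (Fin n) ℝ} (hp : SOSConvex p)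
    {b : ℝ} (hb : ∀ x, b ≤ eval x p) :
    ∃ (u : Fin n → ℝ) (N : ℕ) (c : Fin N → MvPolynomial (Fin n) ℝ),
      p = C (eval u p) + ∑ r, c r * c r := by
  obtain ⟨u, hu⟩ := exists_minimizer_of_convexOn hp.convexOn hb
  obtain ⟨a, N, c, hc, h⟩ := hp.exists_decomposition u
  refine ⟨u, N, c, ?_⟩
  have hline : ∀ t : ℝ, eval (u + t • a) p = eval u p + t * (a ⬝ᵥ a) +
      ∑ r, (alongLine u a (c r)).eval t * (alongLine u a (c r)).eval t := by
    intro t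
    conv_lhs => rw [h]
    simp only [eval_alongLine, map_add, map_sum, map_mul, eval_C, map_sub, eval_X, Pi.add_apply,
      Pi.smul_apply, smul_eq_mul, dotProduct, Finset.mul_sum]
    congr 2
    exact Finset.sum_congr rfl fun i _ => by ring
  have hderiv : HasDerivAt (fun t : ℝ => eval (u + t • a) p) (a ⬝ᵥ a) 0 := by
    have h1 : HasDerivAt (fun t : ℝ => eval u p + t * (a ⬝ᵥ a) +
        ∑ r, (alongLine u a (c r)).eval t * (alongLine u a (c r)).eval t)
        (1 * (a ⬝ᵥ a) + ∑ r, ((alongLine u a (c r)).derivative.eval 0 *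
          (alongLine u a (c r)).eval 0 + (alongLine u a (c r)).eval 0 *
          (alongLine u a (c r)).derivative.eval 0)) 0 :=
      (((hasDerivAt_id 0).mul_const (a ⬝ᵥ a)).const_add _).add
        (HasDerivAt.fun_sum fun r _ => ((alongLine u a (c r)).hasDerivAt 0).mul
          ((alongLine u a (c r)).hasDerivAt 0))
    have h2 : ∀ r, (alongLine u a (c r)).eval 0 = 0 := fun r => by
      rw [eval_alongLine, zero_smul, add_zero, hc]
    simp only [h2, mul_zero, zero_mul, add_zero, Finset.sum_const_zero, one_mul] at h1
    exact h1.congr_of_eventuallyEq (Filter.Eventually.of_forall hline)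
  have hmin : IsLocalMin (fun t : ℝ => eval (u + t • a) p) 0 :=
    Filter.Eventually.of_forall fun t => by simpa using hu _
  have ha : a = 0 := dotProduct_self_eq_zero.1 (hmin.hasDerivAt_eq_zero hderiv)
  rw [ha] at h
  simpa using h

/-! ### Lagrange multipliers -/

lemma isOpen_setOf_quadForm_lt {m : ℕ} (M : Matrix (Fin m) (Fin m) ℝ) :
    IsOpen {S : Matrix (Fin m) (Fin m) ℝ |
      ∀ ξ : Fin m → ℝ, ξ ≠ 0 → ξ ⬝ᵥ (S *ᵥ ξ) < ξ ⬝ᵥ (M *ᵥ ξ)} := by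
  -- By homogeneity it is enough to test the compact unit sphere.
  have h : {S : Matrix (Fin m) (Fin m) ℝ |
      ∀ ξ : Fin m → ℝ, ξ ≠ 0 → ξ ⬝ᵥ (S *ᵥ ξ) < ξ ⬝ᵥ (M *ᵥ ξ)} =
      {S | ∀ ξ ∈ Metric.sphere (0 : Fin m → ℝ) 1, ξ ⬝ᵥ (S *ᵥ ξ) < ξ ⬝ᵥ (M *ᵥ ξ)} := by
    ext S
    refine ⟨fun hS ξ hξ => hS ξ (ne_zero_of_mem_unit_sphere ⟨ξ, hξ⟩), fun hS ξ hξ => ?_⟩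
    have hpos : 0 < ‖ξ‖⁻¹ := inv_pos.2 (norm_pos_iff.2 hξ)
    have h1 := hS (‖ξ‖⁻¹ • ξ) (by
      rw [mem_sphere_zero_iff_norm, norm_smul, norm_inv, norm_norm,
        inv_mul_cancel₀ (norm_ne_zero_iff.2 hξ)])
    simp only [mulVec_smul, dotProduct_smul, smul_dotProduct, smul_eq_mul] at h1
    exact lt_of_mul_lt_mul_left (lt_of_mul_lt_mul_left h1 hpos.le) hpos.le
  rw [h, isOpen_iff_mem_nhds]
  intro S hS
  refine (isCompact_sphere (0 : Fin m → ℝ) 1).eventually_forall_of_forall_eventually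
    (P := fun S ξ => ξ ⬝ᵥ (S *ᵥ ξ) < ξ ⬝ᵥ (M *ᵥ ξ)) fun ξ hξ => ?_
  have hopen : IsOpen {z : Matrix (Fin m) (Fin m) ℝ × (Fin m → ℝ) |
      z.2 ⬝ᵥ (z.1 *ᵥ z.2) < z.2 ⬝ᵥ (M *ᵥ z.2)} :=
    isOpen_lt (by fun_prop) (by fun_prop)
  exact hopen.mem_nhds (hS ξ hξ)

/-- A linear functional on matrices that is nonpositive on all `ξξᵀ` restricts to
`-∑ vₜᵀ M vₜ` on symmetric matrices. -/
lemma exists_eq_neg_sum_quadForm {m : ℕ} (B : Matrix (Fin m) (Fin m) ℝ →ₗ[ℝ] ℝ)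
    (hB : ∀ ξ : Fin m → ℝ, B (vecMulVec ξ ξ) ≤ 0) :
    ∃ (r : ℕ) (v : Fin r → Fin m → ℝ), ∀ M : Matrix (Fin m) (Fin m) ℝ, M.IsSymm →
      B M = -∑ t, v t ⬝ᵥ (M *ᵥ v t) := by
  have hBsum : ∀ M, B M = ∑ i, ∑ j, M i j * B (Matrix.single i j 1) := by
    intro M
    conv_lhs => rw [matrix_eq_sum_single M]
    simp only [map_sum]
    refine Finset.sum_congr rfl fun i _ => Finset.sum_congr rfl fun j _ => ?_
    rw [← smul_eq_mul, ← map_smul, Matrix.smul_single, smul_eq_mul, mul_one]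
  -- The symmetrized coefficient matrix of `-B`.
  set Λ : Matrix (Fin m) (Fin m) ℝ :=
    Matrix.of fun i j => -(B (Matrix.single i j 1) + B (Matrix.single j i 1)) / 2 with hΛ
  have hΛsum : ∀ M : Matrix (Fin m) (Fin m) ℝ, M.IsSymm → ∑ i, ∑ j, M i j * Λ i j = -B M := by
    intro M hM
    have h1 : ∑ i, ∑ j, M i j * B (Matrix.single j i 1) = B M := by
      rw [hBsum M, Finset.sum_comm]
      exact Finset.sum_congr rfl fun i _ => Finset.sum_congr rfl fun j _ => by rw [hM.apply]
    have h2 : ∑ i, ∑ j, M i j * Λ i j = -(∑ i, ∑ j, M i j * B (Matrix.single i j 1) +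
        ∑ i, ∑ j, M i j * B (Matrix.single j i 1)) / 2 := by
      simp only [← Finset.sum_add_distrib, ← Finset.sum_neg_distrib, Finset.sum_div]
      refine Finset.sum_congr rfl fun i _ => Finset.sum_congr rfl fun j _ => ?_
      rw [hΛ, Matrix.of_apply]
      ring
    rw [h2, h1, ← hBsum]
    ring
  have hpsd : Λ.PosSemidef := by
    refine PosSemidef.of_dotProduct_mulVec_nonneg ?_ fun ξ => ?_
    · ext i j
      simp [hΛ, add_comm]
    · have h1 := hΛsum (vecMulVec ξ ξ) (transpose_vecMulVec ξ ξ)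
      have h2 : star ξ ⬝ᵥ (Λ *ᵥ ξ) = ∑ i, ∑ j, vecMulVec ξ ξ i j * Λ i j := by
        simp only [dotProduct, mulVec, star_trivial, Finset.mul_sum, vecMulVec_apply]
        exact Finset.sum_congr rfl fun i _ => Finset.sum_congr rfl fun j _ => by ring
      rw [h2, h1]
      linarith [hB ξ]
  obtain ⟨r, v, hv⟩ := Matrix.posSemidef_iff_eq_sum_vecMulVec.1 hpsd
  refine ⟨r, v, fun M hM => ?_⟩
  rw [← neg_eq_iff_eq_neg, ← hΛsum M hM, hv]
  simp only [Matrix.sum_apply, vecMulVec_apply, star_trivial, Finset.mul_sum, dotProduct, mulVec]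
  conv_rhs => rw [Finset.sum_comm]
  refine Finset.sum_congr rfl fun i _ => ?_
  conv_rhs => rw [Finset.sum_comm]
  exact Finset.sum_congr rfl fun j _ => Finset.sum_congr rfl fun t _ => by ring

/-- Existence of Lagrange multipliers for a convex program with a matrix inequality constraint,
under Slater's condition; the multiplier matrix is given as `∑ vₜ vₜᵀ`. -/
lemma exists_lagrange_multiplier {n m : ℕ} {F : (Fin n → ℝ) → ℝ}
    {H : (Fin n → ℝ) → Matrix (Fin m) (Fin m) ℝ} (hF : ConvexOn ℝ Set.univ F)
    (hH : ∀ ξ : Fin m → ℝ, ConcaveOn ℝ Set.univ fun x => ξ ⬝ᵥ (H x *ᵥ ξ))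
    (hsymm : ∀ x, (H x).IsSymm) {u : Fin n → ℝ} (hu : (H u).PosDef)
    (hFnonneg : ∀ x, (H x).PosSemidef → 0 ≤ F x) :
    ∃ (r : ℕ) (v : Fin r → Fin m → ℝ), ∀ x, 0 ≤ F x - ∑ t, v t ⬝ᵥ (H x *ᵥ v t) := by
  -- The pairs `(s, S)` with `F x < s` and `S` below `H x` for a common `x`.
  -- This set is open among all matrices since only quadratic forms are constrained.
  set A : Set (ℝ × Matrix (Fin m) (Fin m) ℝ) :=
    ⋃ x, {s | F x < s} ×ˢ {S | ∀ ξ : Fin m → ℝ, ξ ≠ 0 → ξ ⬝ᵥ (S *ᵥ ξ) < ξ ⬝ᵥ (H x *ᵥ ξ)} with hA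
  have hmem : ∀ x s S, F x < s → (∀ ξ : Fin m → ℝ, ξ ≠ 0 → ξ ⬝ᵥ (S *ᵥ ξ) < ξ ⬝ᵥ (H x *ᵥ ξ)) →
      (s, S) ∈ A := fun x s S hs hS => Set.mem_iUnion.2 ⟨x, hs, hS⟩
  have hAopen : IsOpen A := isOpen_iUnion fun x => isOpen_Ioi.prod (isOpen_setOf_quadForm_lt _)
  have hAconv : Convex ℝ A := by
    rw [convex_iff_forall_pos]
    rintro ⟨s, S⟩ h1 ⟨s', S'⟩ h2 α β hα hβ hαβ
    obtain ⟨x, hs, hS⟩ := Set.mem_iUnion.1 h1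
    obtain ⟨x', hs', hS'⟩ := Set.mem_iUnion.1 h2
    refine hmem (α • x + β • x') _ _ ?_ fun ξ hξ => ?_
    · refine (hF.2 (Set.mem_univ x) (Set.mem_univ x') hα.le hβ.le hαβ).trans_lt ?_
      exact add_lt_add (mul_lt_mul_of_pos_left hs hα) (mul_lt_mul_of_pos_left hs' hβ)
    · refine lt_of_lt_of_le ?_
        ((hH ξ).2 (Set.mem_univ x) (Set.mem_univ x') hα.le hβ.le hαβ)
      simp only [Prod.smul_mk, add_mulVec, smul_mulVec, dotProduct_add,
        dotProduct_smul]
      exact add_lt_add (mul_lt_mul_of_pos_left (hS ξ hξ) hα)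
        (mul_lt_mul_of_pos_left (hS' ξ hξ) hβ)
  have hA0 : (0 : ℝ × Matrix (Fin m) (Fin m) ℝ) ∉ A := by
    intro h0
    obtain ⟨x, hs, hS⟩ := Set.mem_iUnion.1 h0
    refine absurd (show F x < 0 from hs) (not_lt.2 (hFnonneg x ?_))
    refine PosSemidef.of_dotProduct_mulVec_nonneg (isHermitian_iff_isSymm.2 (hsymm x)) fun ξ => ?_
    by_cases hξ : ξ = 0
    · simp [hξ]
    · have := hS ξ hξ
      simp only [Prod.snd_zero, zero_mulVec, dotProduct_zero] at this
      simpa using this.le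
  obtain ⟨φ, hφ⟩ := geometric_hahn_banach_point_open hAconv hAopen hA0
  rw [map_zero] at hφ
  set a := φ (1, 0) with ha
  set B : Matrix (Fin m) (Fin m) ℝ →ₗ[ℝ] ℝ :=
    φ.toLinearMap ∘ₗ LinearMap.inr ℝ ℝ (Matrix (Fin m) (Fin m) ℝ) with hB
  have hφs : ∀ s S, φ (s, S) = s * a + B S := by
    intro s S
    have h : ((s, S) : ℝ × Matrix (Fin m) (Fin m) ℝ) = s • (1, 0) + (0, S) := by simp
    rw [h, map_add, map_smul, smul_eq_mul]
    rfl
  have hupos : ∀ ξ : Fin m → ℝ, ξ ≠ 0 → 0 < ξ ⬝ᵥ (H u *ᵥ ξ) := fun ξ hξ => by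
    simpa using hu.dotProduct_mulVec_pos hξ
  -- The Slater point makes the multiplier of the objective nonzero.
  have ha0 : 0 < a := by
    have h1 : (|F u| + 1, (0 : Matrix (Fin m) (Fin m) ℝ)) ∈ A :=
      hmem u _ _ (by linarith [le_abs_self (F u)]) fun ξ hξ => by simpa using hupos ξ hξ
    have h2 := hφ _ h1
    rw [hφs, map_zero, add_zero] at h2
    exact pos_of_mul_pos_right h2 (by positivity)
  have hBneg : ∀ ξ : Fin m → ℝ, B (vecMulVec ξ ξ) ≤ 0 := by
    intro ξ
    by_contra! hpos
    -- With this `t`, the functional vanishes at the point `(|F u| + 1, -t ξξᵀ)` of `A`.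
    set t := (|F u| + 1) * a / B (vecMulVec ξ ξ) with ht
    have ht0 : 0 ≤ t := by positivity
    have h1 : (|F u| + 1, (-t) • vecMulVec ξ ξ) ∈ A := by
      refine hmem u _ _ (by linarith [le_abs_self (F u)]) fun η hη => ?_
      refine lt_of_le_of_lt ?_ (hupos η hη)
      rw [smul_mulVec, dotProduct_smul, vecMulVec_mulVec, dotProduct_smul, smul_eq_mul]
      have : 0 ≤ (η ⬝ᵥ ξ) * (η ⬝ᵥ ξ) := mul_self_nonneg _
      simp only [MulOpposite.smul_eq_mul_unop, MulOpposite.unop_op]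
      rw [dotProduct_comm ξ η]
      nlinarith
    have h2 := hφ _ h1
    rw [hφs, map_smul, smul_eq_mul, neg_mul, ht, div_mul_cancel₀ _ hpos.ne'] at h2
    linarith
  obtain ⟨r, v, hv⟩ := exists_eq_neg_sum_quadForm (a⁻¹ • B) fun ξ => by
    rw [LinearMap.smul_apply, smul_eq_mul]
    exact mul_nonpos_of_nonneg_of_nonpos (inv_nonneg.2 ha0.le) (hBneg ξ)
  refine ⟨r, v, fun x => ?_⟩
  have hpos : ∀ ε : ℝ, 0 < ε → 0 ≤ (F x + a⁻¹ * B (H x)) + ε * (1 - a⁻¹ * B 1) := by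
    intro ε hε
    have h1 : (F x + ε, H x - ε • (1 : Matrix (Fin m) (Fin m) ℝ)) ∈ A := by
      refine hmem x _ _ (by linarith) fun ξ hξ => ?_
      rw [sub_mulVec, dotProduct_sub, smul_mulVec, one_mulVec, dotProduct_smul, smul_eq_mul]
      have : 0 < ξ ⬝ᵥ ξ := by simpa using dotProduct_star_self_pos_iff.2 hξ
      linarith [mul_pos hε this]
    have h2 := hφ _ h1
    rw [hφs, map_sub, map_smul, smul_eq_mul] at h2
    have h3 := mul_pos (inv_pos.2 ha0) h2
    have h4 : a⁻¹ * ((F x + ε) * a + (B (H x) - ε * B 1)) =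
        (F x + a⁻¹ * B (H x)) + ε * (1 - a⁻¹ * B 1) := by
      field_simp
      ring
    rw [h4] at h3
    exact h3.le
  have hlim : 0 ≤ F x + a⁻¹ * B (H x) := by
    have hc : Filter.Tendsto (fun ε : ℝ => (F x + a⁻¹ * B (H x)) + ε * (1 - a⁻¹ * B 1))
        (nhdsWithin 0 (Set.Ioi 0)) (nhds (F x + a⁻¹ * B (H x))) := by
      have : Continuous fun ε : ℝ => (F x + a⁻¹ * B (H x)) + ε * (1 - a⁻¹ * B 1) := by fun_prop
      simpa using (this.tendsto 0).mono_left nhdsWithin_le_nhds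
    exact ge_of_tendsto hc (Filter.eventually_of_mem self_mem_nhdsWithin hpos)
  have h1 := hv (H x) (hsymm x)
  rw [LinearMap.smul_apply, smul_eq_mul] at h1
  rw [h1] at hlim
  linarith

/-! ### The sum-of-squares bound -/

lemma SOSConvex.add {n : ℕ} {p q : MvPolynomial (Fin n) ℝ} (hp : SOSConvex p)
    (hq : SOSConvex q) : SOSConvex (p + q) := by
  obtain ⟨k, P, hP⟩ := hp
  obtain ⟨l, Q, hQ⟩ := hq
  refine ⟨k + l, (fromRows P Q).submatrix finSumFinEquiv.symm id, ?_⟩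
  have h : hessian (p + q) = hessian p + hessian q := by
    ext1 i j
    simp [hessian]
  rw [transpose_submatrix, submatrix_mul_equiv, submatrix_id_id, transpose_fromRows,
    fromCols_mul_fromRows, h, hP, hQ]

lemma sosConvex_C {n : ℕ} (a : ℝ) : SOSConvex (C a : MvPolynomial (Fin n) ℝ) :=
  ⟨0, 0, by ext1 i j; simp [hessian]⟩

lemma SOSConvex.sum {n : ℕ} {ι : Type*} (s : Finset ι) {p : ι → MvPolynomial (Fin n) ℝ}
    (hp : ∀ i ∈ s, SOSConvex (p i)) : SOSConvex (∑ i ∈ s, p i) :=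
  Finset.sum_induction p SOSConvex (fun _ _ => SOSConvex.add) (by simpa using sosConvex_C 0) hp

lemma isSumSq_C {n : ℕ} {a : ℝ} (ha : 0 ≤ a) : IsSumSq (C a : MvPolynomial (Fin n) ℝ) := by
  rw [← Real.mul_self_sqrt ha, C_mul]
  exact IsSumSq.mul_self _

lemma eval_nonneg_of_isSumSq {n : ℕ} {σ : MvPolynomial (Fin n) ℝ} (hσ : IsSumSq σ)
    (x : Fin n → ℝ) : 0 ≤ eval x σ := by
  induction hσ with
  | zero => simp
  | sq_add a _ ih =>
    rw [map_add, map_mul]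
    exact add_nonneg (mul_self_nonneg _) ih

theorem sosBound_le_fMin {n m : ℕ} (d : ℕ) (f : MvPolynomial (Fin n) ℝ)
    (G : Matrix (Fin m) (Fin m) (MvPolynomial (Fin n) ℝ)) : sosBound f G d ≤ fMin f G := by
  refine iSup₂_le fun γ hγ => le_iInf₂ fun x hx => EReal.coe_le_coe_iff.2 ?_
  obtain ⟨σ, r, v, hσ, -, -, h⟩ := hγ
  have h1 := congrArg (eval x) h
  have h2 : ∀ t, eval x (v t ⬝ᵥ (G *ᵥ v t)) =
      star (fun i => eval x (v t i)) ⬝ᵥ (evalMat G x *ᵥ fun i => eval x (v t i)) := fun t => by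
    simp [dotProduct, mulVec, evalMat]
  have h3 : 0 ≤ ∑ t, eval x (v t ⬝ᵥ (G *ᵥ v t)) := Finset.sum_nonneg fun t _ => by
    rw [h2]
    exact PosSemidef.dotProduct_mulVec_nonneg hx _
  rw [map_sub, eval_C, map_add, map_sum] at h1
  linarith [eval_nonneg_of_isSumSq hσ x]

/-- Under Slater's condition every real lower bound of the convex program is certified by the
truncated quadratic module. -/
theorem sub_C_mem_qmTrunc {n m d : ℕ} {f : MvPolynomial (Fin n) ℝ}
    {G : Matrix (Fin m) (Fin m) (MvPolynomial (Fin n) ℝ)} (hG : G.IsSymm)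
    (hfdeg : f.totalDegree ≤ 2 * d) (hGdeg : ∀ i j, (G i j).totalDegree ≤ 2 * d)
    (hf : SOSConvex f) (hGconv : SOSConvexMat (-G)) {u : Fin n → ℝ} (hu : (evalMat G u).PosDef)
    {γ : ℝ} (hγ : ∀ x ∈ feasibleSet G, γ ≤ eval x f) : f - C γ ∈ qmTrunc G d := by
  have hfγ : SOSConvex (f - C γ) := by
    rw [sub_eq_add_neg, ← map_neg]
    exact hf.add (sosConvex_C _)
  obtain ⟨r, v, hv⟩ := exists_lagrange_multiplier (H := evalMat G) hfγ.convexOn (fun ξ => by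
      rw [← neg_convexOn_iff]
      refine (hGconv ξ).convexOn.congr fun x _ => ?_
      change eval x _ = -(ξ ⬝ᵥ (evalMat G x *ᵥ ξ))
      rw [neg_mulVec, dotProduct_neg, map_neg, eval_quadForm])
    (fun x => isHermitian_iff_isSymm.1 (isHermitian_evalMat hG x)) hu
    fun x hx => by rw [map_sub, eval_C]; exact sub_nonneg.2 (hγ x hx)
  set V : Fin r → Fin m → MvPolynomial (Fin n) ℝ := fun t i => C (v t i) with hV
  set L := f - C γ - ∑ t, V t ⬝ᵥ (G *ᵥ V t) with hL
  have hLconv : SOSConvex L := by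
    rw [hL, sub_eq_add_neg, ← Finset.sum_neg_distrib]
    refine hfγ.add (SOSConvex.sum _ fun t _ => ?_)
    rw [← dotProduct_neg, ← neg_mulVec]
    exact hGconv (v t)
  have hLnonneg : ∀ x, 0 ≤ eval x L := by
    intro x
    simp only [hL, hV, map_sub (eval x) (f - C γ), map_sum, eval_quadForm]
    exact hv x
  have hqdeg : ∀ t, (V t ⬝ᵥ (G *ᵥ V t)).totalDegree ≤ 2 * d :=
    fun t => totalDegree_quadForm_le hGdeg (v t)
  obtain ⟨w, N, c, hc⟩ := hLconv.exists_eq_min_add_sumSq hLnonneg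
  refine ⟨L, r, V, ?_, ?_, hqdeg, by rw [hL, sub_add_cancel]⟩
  · rw [hc]
    exact (isSumSq_C (hLnonneg w)).add (IsSumSq.sum_mul_self _ _)
  · refine (totalDegree_sub _ _).trans (max_le ((totalDegree_sub_C_le _ _).trans hfdeg) ?_)
    exact totalDegree_finsetSum_le fun t _ => hqdeg t

theorem sosBound_eq_fMin {n m d : ℕ} {f : MvPolynomial (Fin n) ℝ}
    {G : Matrix (Fin m) (Fin m) (MvPolynomial (Fin n) ℝ)} (hG : G.IsSymm)
    (hfdeg : f.totalDegree ≤ 2 * d) (hGdeg : ∀ i j, (G i j).totalDegree ≤ 2 * d)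
    (hf : SOSConvex f) (hGconv : SOSConvexMat (-G)) {u : Fin n → ℝ}
    (hu : (evalMat G u).PosDef) : sosBound f G d = fMin f G := by
  refine le_antisymm (sosBound_le_fMin d f G) (EReal.ge_of_forall_gt_iff_ge.1 fun γ hγ => ?_)
  have h : f - C γ ∈ qmTrunc G d := sub_C_mem_qmTrunc hG hfdeg hGdeg hf hGconv hu fun x hx =>
    EReal.coe_le_coe_iff.1 (hγ.le.trans (iInf₂_le x hx))
  exact le_iSup₂ (f := fun (γ : ℝ) (_ : γ ∈ {γ : ℝ | f - C γ ∈ qmTrunc G d}) => (γ : EReal)) γ h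

end PMO

theorem mainTheorem3 {n m d : ℕ} (hd : 1 ≤ d)
    (f : MvPolynomial (Fin n) ℝ) (G : Matrix (Fin m) (Fin m) (MvPolynomial (Fin n) ℝ))
    (hG : G.IsSymm)
    (hfdeg : f.totalDegree ≤ 2 * d) (hGdeg : ∀ i j, (G i j).totalDegree ≤ 2 * d)
    (hf : PMO.SOSConvex f) (hGconv : PMO.SOSConvexMat (-G)) :
    PMO.momBound f G d = PMO.fMin f G ∧
    ((∃ u : Fin n → ℝ, (PMO.evalMat G u).PosDef) → PMO.sosBound f G d = PMO.fMin f G) ∧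
    (∀ y : PMO.TMS n (2 * d), PMO.IsMomMinimizer f G d y →
      PMO.IsMinimizer f G (fun i => y (PMO.unitIdx (by omega : 1 ≤ 2 * d) i))) := by
  have hd' : 1 ≤ 2 * d := by omega
  refine ⟨PMO.momBound_eq_fMin hd' hG hfdeg hGdeg hf hGconv, ?_, fun y hy => ?_⟩
  · rintro ⟨u, hu⟩
    exact PMO.sosBound_eq_fMin hG hfdeg hGdeg hf hGconv hu
  · exact hy.isMinimizer_firstMoments hd' hG hfdeg hGdeg hf hGconv
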